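/- For $t\in\mathbb{R}$ let $W(t)=e^{-t\partial_x\Delta}$ be the unitary operator on $L^2(\mathbb{R}^3)$ (coordinates $(x,y_1,y_2)$) given by the Fourier multiplier $e^{it\xi(\xi^2+\eta_1^2+\eta_2^2)}$, where $(\xi,\eta_1,\eta_2)$ are the frequency variables dual to $(x,y_1,y_2)$. Let $\varphi(x,y_1,y_2)=e^{-2\sqrt{x^2+y_1^2+y_2^2}}$ and $$u_0=\sum_{k\ge 1}\ \sum_{\substack{j\ge 1\\ \gcd(j,k)=1}} e^{-e^{k}}e^{-j^2}\,W\!\left(-\tfrac{j}{k}\right)\varphi .$$ Call an irrational number $\gamma$ generic if there is $c>0$ such that $|k_1+k_2\gamma|\ge \dfrac{c}{(|k_1|+|k_2|)\ln(|k_1|+|k_2|)}$ for all $k_1,k_2\in\mathbb{Z}$ with $|k_1|+|k_2|\ge 2$. A function in $L^2(\mathbb{R}^3)$ is said to be $C^n$ on an open set if it agrees almost everywhere there with a $C^n$ function. Then the series defining $u_0$ converges unconditionally in $L^2(\mathbb{R}^3)$, $u_0\in C^\infty(\mathbb{R}^3)$, and there is a set $X\subset\mathbb{R}$ of Lebesgue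 measure zero that contains all rational numbers and no generic irrational number, such that 1. $W(t)u_0\in C^\infty(\mathbb{R}^3)$ for every $t>0$ with $t\notin X$; 2. $W(t)u_0\in C^\infty(\mathbb{R}^3\setminus\{0\})$ and $W(t)u_0\notin C^1(\mathbb{R}^3)$ for every rational $t>0$. -/

import Mathlib

open MeasureTheory
open scoped FourierTransform ContDiff

noncomputable section

namespace ZK

/-- The space `ℝ³`; coordinate `0` is `x` and coordinates `1`, `2` are `y₁`, `y₂`. -/
abbrev R3 : Type := EuclideanSpace ℝ (Fin 3)

/-- The complex Hilbert space `L²(ℝ³)`. -/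
abbrev L2 : Type := Lp (α := R3) ℂ 2 volume

/-- The Fourier symbol of `∂ₓ Δ`. With the convention `f̂(ξ) = ∫ e^{-2πi⟨v,ξ⟩} f(v) dv`
the derivative in the `j`-th variable has symbol `2πi ξⱼ`. -/
def symbol (ξ : R3) : ℂ :=
  (2 * Real.pi * Complex.I * (ξ 0 : ℂ)) * ∑ j : Fin 3, (2 * Real.pi * Complex.I * (ξ j : ℂ)) ^ 2

/-- The Fourier multiplier of `W(t) = e^{-t ∂ₓ Δ}`. -/
def multiplier (t : ℝ) (ξ : R3) : ℂ := Complex.exp (-(t : ℂ) * symbol ξ)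

lemma continuous_multiplier (t : ℝ) : Continuous (multiplier t) := by
  unfold multiplier symbol
  fun_prop

lemma norm_multiplier (t : ℝ) (ξ : R3) : ‖multiplier t ξ‖ = 1 := by
  have h : -(t : ℂ) * symbol ξ =
      ((t * (2 * Real.pi * ξ 0) * ∑ j : Fin 3, (2 * Real.pi * ξ j) ^ 2 : ℝ) : ℂ) * Complex.I := by
    unfold symbol
    simp only [mul_pow, Complex.I_sq, Fin.sum_univ_three]
    push_cast
    ring
  rw [multiplier, h, Complex.norm_exp_ofReal_mul_I]

lemma memLp_multiplier_mul (t : ℝ) (f : L2) :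
    MemLp (fun ξ : R3 => multiplier t ξ * f ξ) 2 volume :=
  (memLp_congr_norm
    ((continuous_multiplier t).aestronglyMeasurable.mul (Lp.aestronglyMeasurable f))
    (Lp.aestronglyMeasurable f)
    (Filter.Eventually.of_forall fun ξ => by simp [norm_multiplier])).2 (Lp.memLp f)

/-- The linear propagator `W(t) = e^{-t ∂ₓ Δ}` on `L²(ℝ³)`:
`W(t) f = 𝓕⁻¹ (e^{-t · symbol} · 𝓕 f)`. -/
def W (t : ℝ) (f : L2) : L2 := 𝓕⁻ ((memLp_multiplier_mul t (𝓕 f)).toLp _ : L2)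

/-- `φ(x, y₁, y₂) = e^{-2 √(x² + y₁² + y₂²)}`. -/
def phiFun (v : R3) : ℂ := (Real.exp (-2 * ‖v‖) : ℂ)

lemma memLp_phiFun : MemLp phiFun 2 volume := by
  have hc : Continuous phiFun := by unfold phiFun; fun_prop
  rw [memLp_two_iff_integrable_sq_norm hc.aestronglyMeasurable]
  have hi : Integrable (fun v : R3 => (1 + ‖v‖) ^ (-(4 : ℝ))) volume :=
    integrable_one_add_norm (by simp; norm_num)
  refine hi.mono' (hc.norm.pow 2).aestronglyMeasurable (Filter.Eventually.of_forall fun v => ?_)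
  have h0 : (0 : ℝ) < 1 + ‖v‖ := by positivity
  have h1 : 1 + ‖v‖ ≤ Real.exp ‖v‖ := by linarith [Real.add_one_le_exp ‖v‖]
  have h2 : ‖phiFun v‖ ^ 2 = ((Real.exp ‖v‖) ^ 4)⁻¹ := by
    rw [phiFun, Complex.norm_real, Real.norm_eq_abs, Real.abs_exp, ← Real.exp_nat_mul,
      ← Real.exp_nat_mul, ← Real.exp_neg]
    congr 1
    push_cast
    ring
  have h3 : (1 + ‖v‖) ^ (-(4 : ℝ)) = ((1 + ‖v‖) ^ 4)⁻¹ := by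
    rw [Real.rpow_neg h0.le]
    norm_cast
  rw [Real.norm_of_nonneg (by positivity), h2, h3]
  gcongr

/-- `φ` as an element of `L²(ℝ³)`. -/
def phi : L2 := memLp_phiFun.toLp phiFun

/-- Pairs `(k, j)` of coprime positive integers. -/
abbrev CoprimePair : Type := {p : ℕ+ × ℕ+ // Nat.Coprime (p.2 : ℕ) (p.1 : ℕ)}

/-- The term `e^{-e^k} e^{-j²} W(-j/k) φ` belonging to the pair `(k, j)`. -/
def term (p : CoprimePair) : L2 :=
  ((Real.exp (-Real.exp ((p.1.1 : ℕ) : ℝ)) * Real.exp (-(((p.1.2 : ℕ) : ℝ) ^ 2)) : ℝ) : ℂ) •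
    W (-(((p.1.2 : ℕ) : ℝ) / ((p.1.1 : ℕ) : ℝ))) phi

/-- The initial datum `u₀ = ∑_{k ≥ 1} ∑_{j ≥ 1, gcd(j,k) = 1} e^{-e^k} e^{-j²} W(-j/k) φ`,
the series being taken in `L²(ℝ³)`. -/
def u0 : L2 := ∑' p : CoprimePair, term p

/-- `f ∈ Cⁿ(U)`: on `U`, the `L²` function `f` coincides almost everywhere with a function of
class `Cⁿ` on `U`. -/
def IsCnOn (n : ℕ∞) (f : L2) (U : Set R3) : Prop :=
  ∃ g : R3 → ℂ, ContDiffOn ℝ n g U ∧ ∀ᵐ v ∂(volume.restrict U), f v = g v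

/-- Generic irrational numbers: `|k₁ + k₂ γ| ≳ 1 / ((|k₁| + |k₂|) ln (|k₁| + |k₂|))` for integers
`k₁`, `k₂`, where the right-hand side makes sense, that is for `|k₁| + |k₂| ≥ 2`. -/
def IsGeneric (γ : ℝ) : Prop :=
  Irrational γ ∧ ∃ c : ℝ, 0 < c ∧ ∀ k₁ k₂ : ℤ, 2 ≤ |k₁| + |k₂| →
    c / (((|k₁| + |k₂| : ℤ) : ℝ) * Real.log ((|k₁| + |k₂| : ℤ) : ℝ)) ≤ |(k₁ : ℝ) + (k₂ : ℝ) * γ|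

end ZK

end

/-!
The function `φ` has an exponentially decaying profile, so its Fourier transform is holomorphic
in a strip in the variable dual to `x`, and `W(s) φ` may be computed along a line `Im ζ = κ / 2π`
with `|κ| = 1`. For `s κ > 0` the multiplier becomes a Gaussian of rate `|s|` there (Kato
smoothing): `e^{κx} W(s) φ` is smooth, a derivative of order `m` costing at most a factor
`C_m e^{2|s|} |s|^{-m}`.

At time `t` the term of `u₀` belonging to `(k, j)` is `e^{-e^k} e^{-j²} W(t - j/k) φ`. Unless `t`
is a Liouville number, `|t - j/k|⁻¹` is at most polynomial in `k` when `j/k ≠ t`, which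
`e^{-e^k}` absorbs, so these terms sum to a smooth function. What is left is a positive multiple of
`φ` if `t` is a positive rational and nothing otherwise, and `φ` is smooth except for its kink
at `0`.
-/

namespace ZK

open Filter Topology
open Complex (I)
open scoped Real

section Lp

theorem fourierInv_toLp_ae_eq {V E : Type*} [NormedAddCommGroup V] [InnerProductSpace ℝ V]
    [FiniteDimensional ℝ V] [MeasurableSpace V] [BorelSpace V]
    [NormedAddCommGroup E] [InnerProductSpace ℂ E] [CompleteSpace E] {f : V → E}
    (hf₁ : Integrable f) (hf₂ : MemLp f 2 volume) :
    (𝓕⁻ (hf₂.toLp f) : Lp (α := V) E 2 volume) =ᵐ[volume] 𝓕⁻ f := by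
  have hinner : Continuous fun p : V × V => (-innerₗ V) p.1 p.2 := by
    simpa using! continuous_inner.neg
  have hcont : Continuous (𝓕⁻ f) :=
    VectorFourier.fourierIntegral_continuous Real.continuous_fourierChar hinner hf₁
  refine ae_eq_of_integral_contDiff_smul_eq
    ((Lp.memLp _).locallyIntegrable (by norm_num)) hcont.locallyIntegrable
    fun h h_smooth h_cpt => ?_
  have hg₁ : HasCompactSupport (Complex.ofRealCLM ∘ h) := h_cpt.comp_left rfl
  have hg₂ : ContDiff ℝ ∞ (Complex.ofRealCLM ∘ h) := by fun_prop
  set g := hg₁.toSchwartzMap hg₂ with hg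
  have hflip : (-innerₗ V).flip = -innerₗ V := by
    ext x y
    simp [real_inner_comm]
  calc ∫ x, h x • (𝓕⁻ (hf₂.toLp f) : Lp (α := V) E 2 volume) x
      = Lp.toTemperedDistribution (𝓕⁻ (hf₂.toLp f) : Lp (α := V) E 2 volume) g := by
        simp [hg, Lp.toTemperedDistribution_apply]
    _ = ∫ x, (𝓕⁻ (g : V → ℂ)) x • f x := by
        rw [← Lp.fourierInv_toTemperedDistribution_eq, TemperedDistribution.fourierInv_apply,
          Lp.toTemperedDistribution_apply]
        apply integral_congr_ae
        filter_upwards [hf₂.coeFn_toLp] with x hx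
        rw [hx, SchwartzMap.fourierInv_coe]
    _ = ∫ x, g x • 𝓕⁻ f x := by
        have := VectorFourier.integral_fourierIntegral_smul_eq_flip (μ := volume) (ν := volume)
          Real.continuous_fourierChar hinner g.integrable hf₁
        rwa [hflip] at this
    _ = ∫ x, h x • 𝓕⁻ f x := by simp [hg]

theorem tsum_ae_eq_of_hasSum {α ι E : Type*} [Countable ι] [MeasurableSpace α] {μ : Measure α}
    [NormedAddCommGroup E] {p : ENNReal} [Fact (1 ≤ p)] {F : ι → Lp E p μ} {f : ι → α → E}
    {g : α → E} (hF : Summable F) (hFf : ∀ i, F i =ᵐ[μ] f i)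
    (hfg : ∀ x, HasSum (fun i => f i x) (g x)) :
    (∑' i, F i : Lp E p μ) =ᵐ[μ] g := by
  obtain ⟨s, hs, hlim⟩ := (tendstoInMeasure_of_tendsto_Lp hF.hasSum).exists_seq_tendsto_ae'
  filter_upwards [hlim, ae_all_iff.2 hFf, ae_all_iff.2 fun n => Lp.coeFn_finsetSum (s n) F]
    with x hx hFx hsum
  refine tendsto_nhds_unique hx (((hfg x).comp hs).congr fun n => ?_)
  rw [hsum n]
  simp [hFx]

end Lp

section FourierSmooth

variable {V E : Type*} [NormedAddCommGroup V] [InnerProductSpace ℝ V] [FiniteDimensional ℝ V]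
  [MeasurableSpace V] [BorelSpace V] [NormedAddCommGroup E] [NormedSpace ℂ E] {f : V → E}

theorem norm_fourierInv_le_integral_norm (f : V → E) (v : V) : ‖𝓕⁻ f v‖ ≤ ∫ ξ, ‖f ξ‖ :=
  VectorFourier.norm_fourierIntegral_le_integral_norm _ _ _ _ _

theorem contDiff_fourierInv (hf : ∀ n : ℕ, Integrable fun ξ => ‖ξ‖ ^ n * ‖f ξ‖) :
    ContDiff ℝ ∞ (𝓕⁻ f) :=
  VectorFourier.contDiff_fourierIntegral (-innerSL ℝ) fun n _ => hf n

theorem norm_iteratedFDeriv_fourierInv_le (hf : ∀ n : ℕ, Integrable fun ξ => ‖ξ‖ ^ n * ‖f ξ‖)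
    (hf' : AEStronglyMeasurable f) (k : ℕ) (v : V) :
    ‖iteratedFDeriv ℝ k (𝓕⁻ f) v‖ ≤ (2 * π) ^ k * ∫ ξ, ‖ξ‖ ^ k * ‖f ξ‖ := by
  have h := VectorFourier.iteratedFDeriv_fourierIntegral (-innerSL ℝ) (N := ⊤) (fun n _ => hf n) hf'
    (le_top (a := (k : ℕ∞)))
  have hL : 2 * π * ‖(-innerSL ℝ : V →L[ℝ] V →L[ℝ] ℝ)‖ ≤ 2 * π :=
    mul_le_of_le_one_right Real.two_pi_pos.le
      ((norm_neg (innerSL ℝ)).trans_le (norm_innerSL_le ℝ))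
  calc ‖iteratedFDeriv ℝ k (𝓕⁻ f) v‖
      ≤ ∫ ξ, ‖VectorFourier.fourierPowSMulRight (-innerSL ℝ) f ξ k‖ :=
        (congrArg norm (congrFun h v)).trans_le
          (VectorFourier.norm_fourierIntegral_le_integral_norm _ _ _ _ _)
    _ ≤ ∫ ξ, (2 * π) ^ k * (‖ξ‖ ^ k * ‖f ξ‖) := by
        refine integral_mono_of_nonneg (.of_forall fun ξ => norm_nonneg _)
          ((hf k).const_mul _) (.of_forall fun ξ => ?_)
        refine (VectorFourier.norm_fourierPowSMulRight_le _ _ _ _).trans ?_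
        rw [mul_assoc]
        exact mul_le_mul_of_nonneg_right (pow_le_pow_left₀ (by positivity) hL k) (by positivity)
    _ = (2 * π) ^ k * ∫ ξ, ‖ξ‖ ^ k * ‖f ξ‖ := integral_const_mul _ _

end FourierSmooth

section ContourShift

variable {E : Type*} [NormedAddCommGroup E] [NormedSpace ℂ E] {β : ℝ}

/- The vertical sides of the rectangle with corners `-T` and `T + β I` contribute nothing in the
limit `T → ∞`. -/
theorem integral_eq_integral_add_mul_I {f : ℂ → E} {B : ℝ → ℝ}
    (hf : DifferentiableOn ℂ f {z | z.im ∈ Set.uIcc 0 β})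
    (hfB : ∀ x : ℝ, ∀ y ∈ Set.uIcc 0 β, ‖f (x + y * I)‖ ≤ B x)
    (hB : Tendsto B (cocompact ℝ) (𝓝 0))
    (hf₀ : Integrable fun x : ℝ => f x) (hf₁ : Integrable fun x : ℝ => f (x + β * I)) :
    ∫ x : ℝ, f x = ∫ x : ℝ, f (x + β * I) := by
  rw [cocompact_eq_atBot_atTop, tendsto_sup] at hB
  have hrect (T : ℝ) : (∫ x in -T..T, f x) - (∫ x in -T..T, f (x + β * I)) +
      I • (∫ y in (0 : ℝ)..β, f (T + y * I)) -
      I • (∫ y in (0 : ℝ)..β, f ((-T : ℝ) + y * I)) = 0 := by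
    simpa using Complex.integral_boundary_rect_eq_zero_of_differentiableOn f ((-T : ℝ) : ℂ)
      (T + β * I) (hf.mono fun z hz => by simpa using hz.2)
  have hside {u : ℝ → ℝ} (hu : Tendsto (fun T => B (u T)) atTop (𝓝 0)) :
      Tendsto (fun T => I • ∫ y in (0 : ℝ)..β, f (u T + y * I)) atTop (𝓝 0) := by
    refine squeeze_zero_norm (a := fun T => B (u T) * |β - 0|) (fun T => ?_)
      (by simpa using hu.mul_const |β - 0|)
    rw [norm_smul, Complex.norm_I, one_mul]
    exact intervalIntegral.norm_integral_le_of_norm_le_const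
      fun y hy => hfB _ _ (Set.uIoc_subset_uIcc hy)
  have hlim := (((intervalIntegral_tendsto_integral hf₀ tendsto_neg_atTop_atBot tendsto_id).sub
    (intervalIntegral_tendsto_integral hf₁ tendsto_neg_atTop_atBot tendsto_id)).add
    (hside hB.2)).sub (hside (hB.1.comp tendsto_neg_atTop_atBot))
  have := tendsto_nhds_unique (hlim.congr hrect) tendsto_const_nhds
  simpa [sub_eq_zero] using this

theorem integral_prod_eq_integral_prod_add_mul_I {F : Type*} [MeasureSpace F]
    [SFinite (volume : Measure F)] {f : ℂ → F → E} {B : ℝ → ℝ}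
    (hf : ∀ p, DifferentiableOn ℂ (fun z => f z p) {z | z.im ∈ Set.uIcc 0 β})
    (hfB : ∀ p, ∀ x : ℝ, ∀ y ∈ Set.uIcc 0 β, ‖f (x + y * I) p‖ ≤ B x)
    (hB : Tendsto B (cocompact ℝ) (𝓝 0))
    (hf₀ : Integrable fun q : ℝ × F => f q.1 q.2)
    (hf₁ : Integrable fun q : ℝ × F => f (q.1 + β * I) q.2) :
    ∫ q : ℝ × F, f q.1 q.2 = ∫ q : ℝ × F, f (q.1 + β * I) q.2 := by
  rw [Measure.volume_eq_prod] at hf₀ hf₁ ⊢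
  rw [integral_prod_symm _ hf₀, integral_prod_symm _ hf₁]
  refine integral_congr_ae ?_
  filter_upwards [hf₀.prod_left_ae, hf₁.prod_left_ae] with p h₀ h₁
  exact integral_eq_integral_add_mul_I (hf p) (hfB p) hB h₀ h₁

end ContourShift

section Coordinates

variable {E : Type*} [NormedAddCommGroup E]

/-- The splitting `ℝ³ = ℝ × (ℝ × ℝ)` into the `x`-axis and the transverse plane. -/
noncomputable def splitEquiv : R3 ≃ᵐ ℝ × ℝ × ℝ :=
  (MeasurableEquiv.toLp 2 (Fin 3 → ℝ)).symm.trans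
    ((MeasurableEquiv.piFinSuccAbove (fun _ => ℝ) 0).trans
      ((MeasurableEquiv.refl ℝ).prodCongr MeasurableEquiv.finTwoArrow))

theorem measurePreserving_splitEquiv : MeasurePreserving splitEquiv :=
  (EuclideanSpace.volume_preserving_symm_measurableEquiv_toLp (Fin 3)).trans <|
    (volume_preserving_piFinSuccAbove (fun _ : Fin 3 => ℝ) 0).trans <|
      (MeasurePreserving.id volume).prod (volume_preserving_finTwoArrow ℝ)

theorem integral_coords [NormedSpace ℝ E] (f : ℝ × ℝ × ℝ → E) :
    ∫ ξ : R3, f (ξ 0, ξ 1, ξ 2) = ∫ p, f p :=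
  measurePreserving_splitEquiv.integral_comp splitEquiv.measurableEmbedding f

theorem integrable_coords {f : ℝ × ℝ × ℝ → E} :
    Integrable (fun ξ : R3 => f (ξ 0, ξ 1, ξ 2)) ↔ Integrable f :=
  measurePreserving_splitEquiv.integrable_comp_emb splitEquiv.measurableEmbedding

theorem norm_sq_eq_coords (ξ : R3) : ‖ξ‖ ^ 2 = ξ 0 ^ 2 + (ξ 1 ^ 2 + ξ 2 ^ 2) := by
  rw [EuclideanSpace.real_norm_sq_eq, Fin.sum_univ_three, add_assoc]

theorem inner_eq_coords (ξ v : R3) : inner ℝ ξ v = ξ 0 * v 0 + ξ 1 * v 1 + ξ 2 * v 2 := by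
  simp [PiLp.inner_apply, Fin.sum_univ_three, mul_comm]

variable [NormedSpace ℂ E]

theorem integrable_fourierInv_integrand {V : Type*} [NormedAddCommGroup V]
    [InnerProductSpace ℝ V] [MeasurableSpace V] [BorelSpace V]
    {μ : Measure V} {f : V → E} (hf : Integrable f μ) (v : V) :
    Integrable (fun ξ => Complex.exp (↑(2 * π * inner ℝ ξ v) * I) • f ξ) μ := by
  have hc : Continuous fun ξ : V => Complex.exp (↑(2 * π * inner ℝ ξ v) * I) := by fun_prop
  refine hf.mono (hc.aestronglyMeasurable.smul hf.1) (.of_forall fun ξ => ?_)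
  rw [norm_smul, Complex.norm_exp_ofReal_mul_I, one_mul]

theorem norm_exp_two_pi_mul_I_le {β x y : ℝ} (hy : y ∈ Set.uIcc 0 β) (u w : ℝ) :
    ‖Complex.exp (2 * π * ((x + y * I) * u + w) * I)‖ ≤ Real.exp (2 * π * |β| * |u|) := by
  have hre : (2 * π * ((x + y * I) * u + w) * I : ℂ).re = -(2 * π * (y * u)) := by simp
  have hyβ : |y| ≤ |β| := by simpa using Set.abs_sub_left_of_mem_uIcc hy
  rw [Complex.norm_exp, hre, Real.exp_le_exp]
  calc -(2 * π * (y * u)) ≤ |2 * π * (y * u)| := neg_le_abs _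
    _ = 2 * π * |y| * |u| := by
      rw [abs_mul (2 * π), abs_of_pos Real.two_pi_pos, abs_mul, mul_assoc (2 * π)]
    _ ≤ 2 * π * |β| * |u| := by gcongr

theorem fourierInv_eq_exp_smul_fourierInv_shift {G : ℂ → ℝ × ℝ → E} {β : ℝ}
    {B : ℝ → ℝ} (hG : ∀ p, DifferentiableOn ℂ (fun z => G z p) {z | z.im ∈ Set.uIcc 0 β})
    (hGB : ∀ p, ∀ x : ℝ, ∀ y ∈ Set.uIcc 0 β, ‖G (x + y * I) p‖ ≤ B x)
    (hB : Tendsto B (cocompact ℝ) (𝓝 0))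
    (hG₀ : Integrable fun ξ : R3 => G (ξ 0) (ξ 1, ξ 2))
    (hG₁ : Integrable fun ξ : R3 => G (ξ 0 + β * I) (ξ 1, ξ 2)) (v : R3) :
    𝓕⁻ (fun ξ : R3 => G (ξ 0) (ξ 1, ξ 2)) v =
      Complex.exp (-(2 * π * β * v 0)) • 𝓕⁻ (fun ξ : R3 => G (ξ 0 + β * I) (ξ 1, ξ 2)) v := by
  let F (z : ℂ) (p : ℝ × ℝ) : E :=
    Complex.exp (2 * π * (z * v 0 + (p.1 * v 1 + p.2 * v 2 : ℝ)) * I) • G z p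
  have hF₀ (ξ : R3) : Complex.exp (↑(2 * π * inner ℝ ξ v) * I) • G (ξ 0) (ξ 1, ξ 2) =
      F (ξ 0) (ξ 1, ξ 2) := by
    simp only [F, inner_eq_coords]
    congr 2
    push_cast
    ring
  have hF₁ (ξ : R3) : Complex.exp (-(2 * π * β * v 0)) •
      Complex.exp (↑(2 * π * inner ℝ ξ v) * I) • G (ξ 0 + β * I) (ξ 1, ξ 2) =
      F (ξ 0 + β * I) (ξ 1, ξ 2) := by
    rw [smul_smul, ← Complex.exp_add, inner_eq_coords]
    congr 2
    push_cast
    linear_combination (-2 * π * β * v 0 : ℂ) * Complex.I_sq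
  simp_rw [Real.fourierInv_eq', ← integral_smul, hF₀, hF₁]
  rw [integral_coords fun q => F q.1 q.2, integral_coords fun q => F (q.1 + β * I) q.2]
  refine integral_prod_eq_integral_prod_add_mul_I (F := ℝ × ℝ)
    (B := fun x => Real.exp (2 * π * |β| * |v 0|) * B x)
    (fun p => DifferentiableOn.smul (by fun_prop) (hG p)) (fun p x y hy => ?_)
    (by simpa using hB.const_mul _) ?_ ?_
  · rw [norm_smul]
    gcongr
    exacts [norm_exp_two_pi_mul_I_le hy _ _, hGB p x y hy]
  · refine (integrable_coords (f := fun q => F q.1 q.2)).1 ?_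
    simpa only [← hF₀] using integrable_fourierInv_integrand hG₀ v
  · refine (integrable_coords (f := fun q => F (q.1 + β * I) q.2)).1 ?_
    simpa only [← hF₁] using! (integrable_fourierInv_integrand hG₁ v).smul _

end Coordinates

section Exponential

variable {a : ℝ}

theorem integrable_exp_neg_mul_abs (ha : 0 < a) :
    Integrable fun x : ℝ => ((Real.exp (-a * |x|) : ℝ) : ℂ) := by
  suffices h : Integrable fun x : ℝ => Real.exp (-a * |x|) from h.ofReal
  rw [← integrableOn_univ, ← Set.Iic_union_Ioi (a := (0 : ℝ)), integrableOn_union]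
  constructor
  · refine (integrableOn_exp_mul_Iic ha 0).congr_fun (fun x hx => ?_) measurableSet_Iic
    simp [abs_of_nonpos (Set.mem_Iic.1 hx)]
  · refine (integrableOn_exp_mul_Ioi (neg_lt_zero.2 ha) 0).congr_fun (fun x hx => ?_)
      measurableSet_Ioi
    simp [abs_of_pos (Set.mem_Ioi.1 hx)]

theorem fourier_exp_neg_mul_abs (ha : 0 < a) (τ : ℝ) :
    𝓕 (fun x : ℝ => ((Real.exp (-a * |x|) : ℝ) : ℂ)) τ =
      ((2 * a / (a ^ 2 + (2 * π * τ) ^ 2) : ℝ) : ℂ) := by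
  let w : ℂ := (2 * π * τ : ℝ) * I
  have hw : w.re = 0 := by simp [w]
  have hint : Integrable fun x : ℝ => Complex.exp (↑(-2 * π * x * τ) * I) •
      ((Real.exp (-a * |x|) : ℝ) : ℂ) := by
    refine (integrable_exp_neg_mul_abs ha).mono (by fun_prop) (.of_forall fun x => ?_)
    rw [norm_smul, Complex.norm_exp_ofReal_mul_I, one_mul]
  have hneg : ∀ x ∈ Set.Iic (0 : ℝ), Complex.exp (↑(-2 * π * x * τ) * I) •
      ((Real.exp (-a * |x|) : ℝ) : ℂ) = Complex.exp ((a - w) * x) := fun x hx => by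
    rw [abs_of_nonpos hx, smul_eq_mul, Complex.ofReal_exp, ← Complex.exp_add]
    congr 1
    simp only [w]
    push_cast
    ring
  have hpos : ∀ x ∈ Set.Ioi (0 : ℝ), Complex.exp (↑(-2 * π * x * τ) * I) •
      ((Real.exp (-a * |x|) : ℝ) : ℂ) = Complex.exp ((-a - w) * x) := fun x hx => by
    rw [abs_of_pos hx, smul_eq_mul, Complex.ofReal_exp, ← Complex.exp_add]
    congr 1
    simp only [w]
    push_cast
    ring
  have hsub : (a - w : ℂ) ≠ 0 := fun h => ha.ne' (by simpa [hw] using congrArg Complex.re h)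
  have hadd : (-a - w : ℂ) ≠ 0 := fun h => ha.ne' (by simpa [hw] using congrArg Complex.re h)
  have hden : ((a ^ 2 + (2 * π * τ) ^ 2 : ℝ) : ℂ) ≠ 0 :=
    Complex.ofReal_ne_zero.2 (by positivity)
  rw [Real.fourier_real_eq_integral_exp_smul, ← intervalIntegral.integral_Iic_add_Ioi (b := 0)
    hint.integrableOn hint.integrableOn, setIntegral_congr_fun measurableSet_Iic hneg,
    setIntegral_congr_fun measurableSet_Ioi hpos, integral_exp_mul_complex_Iic (by simpa [hw]),
    integral_exp_mul_complex_Ioi (by simpa [hw])]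
  simp only [Complex.ofReal_zero, mul_zero, Complex.exp_zero]
  rw [div_add_div _ _ hsub hadd, Complex.ofReal_div,
    div_eq_div_iff (mul_ne_zero hsub hadd) hden]
  simp only [w]
  push_cast
  linear_combination (-8 * (a : ℂ) * (π * τ) ^ 2) * Complex.I_sq

theorem fourierInv_two_mul_div_sq_add_sq (ha : 0 < a) (x : ℝ) :
    𝓕⁻ (fun τ : ℝ => ((2 * a / (a ^ 2 + (2 * π * τ) ^ 2) : ℝ) : ℂ)) x =
      ((Real.exp (-a * |x|) : ℝ) : ℂ) := by
  have hfourier := funext (fourier_exp_neg_mul_abs ha)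
  have hint : Integrable fun τ : ℝ => ((2 * a / (a ^ 2 + (2 * π * τ) ^ 2) : ℝ) : ℂ) := by
    suffices h : Integrable fun τ : ℝ => 2 * a / (a ^ 2 + (2 * π * τ) ^ 2) from h.ofReal
    refine ((integrable_inv_one_add_sq.comp_mul_left' (R := 2 * π / a)
      (by positivity)).const_mul (2 / a)).congr (.of_forall fun τ => ?_)
    field_simp
  rw [← hfourier, Continuous.fourierInv_fourier_eq (by fun_prop)
    (integrable_exp_neg_mul_abs ha) (hfourier ▸ hint)]

end Exponential

section Radial

theorem integral_comp_sq_add_sq {E : Type*} [NormedAddCommGroup E] [NormedSpace ℝ E]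
    (g : ℝ → E) :
    ∫ p : ℝ × ℝ, g (p.1 ^ 2 + p.2 ^ 2) = π • ∫ u in Set.Ioi (0 : ℝ), g u := by
  have hpolar (p : ℝ × ℝ) :
      (polarCoord.symm p).1 ^ 2 + (polarCoord.symm p).2 ^ 2 = p.1 ^ 2 := by
    rw [polarCoord_symm_apply]
    linear_combination p.1 ^ 2 * Real.cos_sq_add_sin_sq p.2
  rw [← integral_comp_polarCoord_symm]
  simp_rw [hpolar]
  rw [polarCoord_target, Measure.volume_eq_prod, ← Measure.prod_restrict,
    integral_fun_fst (fun r : ℝ => r • g (r ^ 2)), measureReal_restrict_apply_univ,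
    Real.volume_real_Ioo_of_le (by linarith [Real.pi_pos]),
    ← integral_comp_rpow_Ioi_of_pos (g := g) two_pos]
  norm_num [mul_smul, integral_smul]
  rw [smul_smul]
  ring_nf

theorem integral_Ioi_inv_add_mul_sq {A B : ℝ} (hA : 0 < A) (hB : 0 < B) :
    ∫ u in Set.Ioi (0 : ℝ), ((A + B * u) ^ 2)⁻¹ = (A * B)⁻¹ := by
  have hlim : Tendsto (fun u => -(B * (A + B * u))⁻¹) atTop (𝓝 (-0)) :=
    (tendsto_inv_atTop_zero.comp <|
      (tendsto_atTop_add_const_left _ A (tendsto_id.const_mul_atTop hB)).const_mul_atTop hB).neg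
  rw [integral_Ioi_of_hasDerivAt_of_nonneg' (fun u hu => ?_) (fun u _ => by positivity) hlim]
  · simp [mul_comm]
  · have hu : A + B * u ≠ 0 := by
      have := mul_nonneg hB.le (Set.mem_Ici.1 hu)
      positivity
    have hd : HasDerivAt (fun u => B * (A + B * u)) (B * B) u := by
      simpa using (((hasDerivAt_id u).const_mul B).const_add A).const_mul B
    refine (hd.inv (mul_ne_zero hB.ne' hu)).neg.congr_deriv ?_
    field_simp

theorem fourierInv_eq_of_norm_eq {V E : Type*} [NormedAddCommGroup V] [InnerProductSpace ℝ V]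
    [FiniteDimensional ℝ V] [MeasurableSpace V] [BorelSpace V] [NormedAddCommGroup E]
    [NormedSpace ℂ E] {f : V → E} (hf : ∀ ξ η, ‖ξ‖ = ‖η‖ → f ξ = f η) {v w : V}
    (hvw : ‖v‖ = ‖w‖) : 𝓕⁻ f v = 𝓕⁻ f w := by
  let A := (ℝ ∙ (v - w))ᗮ.reflection
  have hfA : f ∘ A = f := funext fun ξ => hf _ _ (A.norm_map ξ)
  rw [← Submodule.reflection_sub hvw, ← Real.fourierInv_comp_linearIsometry, hfA]

theorem fourierInv_single_eq_fourierInv_integral {E : Type*} [NormedAddCommGroup E]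
    [NormedSpace ℂ E] {f : ℝ → ℝ × ℝ → E} (hf : Integrable fun ξ : R3 => f (ξ 0) (ξ 1, ξ 2))
    (r : ℝ) :
    𝓕⁻ (fun ξ : R3 => f (ξ 0) (ξ 1, ξ 2)) (EuclideanSpace.single 0 r) =
      𝓕⁻ (fun τ => ∫ p, f τ p) r := by
  let F (q : ℝ × ℝ × ℝ) : E := Complex.exp (↑(2 * π * (q.1 * r)) * I) • f q.1 q.2
  have hF (ξ : R3) : Complex.exp (↑(2 * π * inner ℝ ξ (EuclideanSpace.single 0 r)) * I) •
      f (ξ 0) (ξ 1, ξ 2) = F (ξ 0, ξ 1, ξ 2) := by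
    simp [F, inner_eq_coords]
  have hint : Integrable F := integrable_coords.1 <| by
    simpa only [hF] using integrable_fourierInv_integrand hf (EuclideanSpace.single 0 r)
  simp_rw [Real.fourierInv_eq', hF]
  rw [integral_coords, Measure.volume_eq_prod, integral_prod _ hint]
  simp [F, integral_smul, mul_comm]

end Radial

section PhiHat

/-- The Fourier transform `π (1 + π² |ξ|²)⁻²` of `φ`, as a function of the complexified first
frequency `z` and of `q = ξ₁² + ξ₂²`. -/
noncomputable def phiHat (z : ℂ) (q : ℝ) : ℂ :=
  π / (1 + (π : ℂ) ^ 2 * (z ^ 2 + q)) ^ 2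

variable {z : ℂ} {q : ℝ}

theorem three_quarters_mul_le_re (hz : |2 * π * z.im| ≤ 1) (hq : 0 ≤ q) :
    3 / 4 * (1 + (z.re ^ 2 + q)) ≤ (1 + (π : ℂ) ^ 2 * (z ^ 2 + q)).re := by
  have hre : (1 + (π : ℂ) ^ 2 * (z ^ 2 + q)).re = 1 + π ^ 2 * (z.re ^ 2 - z.im ^ 2 + q) := by
    rw [← Complex.ofReal_pow, Complex.add_re, Complex.re_ofReal_mul]
    simp [sq]
  have him : (2 * π * z.im) ^ 2 ≤ 1 := (sq_le_one_iff_abs_le_one _).2 hz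
  have hpi : 1 * (z.re ^ 2 + q) ≤ π ^ 2 * (z.re ^ 2 + q) := by
    gcongr
    nlinarith [Real.pi_gt_three]
  nlinarith [sq_nonneg z.re]

theorem one_add_pi_sq_mul_ne_zero (hz : |2 * π * z.im| ≤ 1) (hq : 0 ≤ q) :
    1 + (π : ℂ) ^ 2 * (z ^ 2 + q) ≠ 0 := fun h => by
  have := three_quarters_mul_le_re hz hq
  rw [h, Complex.zero_re] at this
  nlinarith [sq_nonneg z.re]

theorem norm_phiHat_le (hz : |2 * π * z.im| ≤ 1) (hq : 0 ≤ q) :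
    ‖phiHat z q‖ ≤ 2 * π * ((1 + (z.re ^ 2 + q)) ^ 2)⁻¹ := by
  have hden := (three_quarters_mul_le_re hz hq).trans (Complex.re_le_norm _)
  have : 0 < 1 + (z.re ^ 2 + q) := by positivity
  rw [phiHat, norm_div, norm_pow, Complex.norm_real, Real.norm_of_nonneg Real.pi_pos.le]
  calc π / _ ^ 2 ≤ π / (3 / 4 * (1 + (z.re ^ 2 + q))) ^ 2 := by gcongr
    _ = 16 / 9 * π * ((1 + (z.re ^ 2 + q)) ^ 2)⁻¹ := by
      field_simp
      norm_num
    _ ≤ 2 * π * ((1 + (z.re ^ 2 + q)) ^ 2)⁻¹ := by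
      gcongr
      norm_num

theorem integral_phiHat (τ : ℝ) :
    ∫ p : ℝ × ℝ, phiHat τ (p.1 ^ 2 + p.2 ^ 2) =
      ((2 * 2 / (2 ^ 2 + (2 * π * τ) ^ 2) : ℝ) : ℂ) := by
  have hphi (u : ℝ) : phiHat τ u =
      ((π * ((1 + π ^ 2 * τ ^ 2 + π ^ 2 * u) ^ 2)⁻¹ : ℝ) : ℂ) := by
    rw [phiHat]
    push_cast
    ring
  rw [integral_comp_sq_add_sq]
  simp_rw [hphi]
  rw [integral_complex_ofReal, integral_const_mul,
    integral_Ioi_inv_add_mul_sq (by positivity) (by positivity), Complex.real_smul,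
    ← Complex.ofReal_mul]
  congr 1
  field_simp

theorem fourierInv_phiHat (h : Integrable fun ξ : R3 => phiHat (ξ 0) (ξ 1 ^ 2 + ξ 2 ^ 2)) (v : R3) :
    𝓕⁻ (fun ξ : R3 => phiHat (ξ 0) (ξ 1 ^ 2 + ξ 2 ^ 2)) v = phiFun v := by
  have hradial (ξ η : R3) (hξη : ‖ξ‖ = ‖η‖) :
      phiHat (ξ 0) (ξ 1 ^ 2 + ξ 2 ^ 2) = phiHat (η 0) (η 1 ^ 2 + η 2 ^ 2) := by
    have hsq := congrArg (fun r : ℝ => ((r ^ 2 : ℝ) : ℂ)) hξη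
    simp only [norm_sq_eq_coords, Complex.ofReal_add (_ ^ 2) (_ + _), Complex.ofReal_pow] at hsq
    rw [phiHat, phiHat, hsq]
  have hnorm : ‖v‖ = ‖(EuclideanSpace.single 0 ‖v‖ : R3)‖ := by simp
  rw [fourierInv_eq_of_norm_eq hradial hnorm,
    fourierInv_single_eq_fourierInv_integral
      (f := fun τ p => phiHat τ (p.1 ^ 2 + p.2 ^ 2)) h]
  simp_rw [integral_phiHat]
  rw [fourierInv_two_mul_div_sq_add_sq two_pos, abs_norm, phiFun]

end PhiHat

section Multiplier

/-- The multiplier of `W(s)`, as a function of the complexified first frequency `z` and of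
`q = ξ₁² + ξ₂²`. -/
noncomputable def cmultiplier (s : ℝ) (z : ℂ) (q : ℝ) : ℂ :=
  Complex.exp (s * (2 * π) ^ 3 * I * z * (z ^ 2 + q))

theorem multiplier_eq_cmultiplier (s : ℝ) (ξ : R3) :
    multiplier s ξ = cmultiplier s (ξ 0) (ξ 1 ^ 2 + ξ 2 ^ 2) := by
  rw [multiplier, cmultiplier, symbol, Fin.sum_univ_three]
  congr 1
  push_cast
  linear_combination (-(s : ℂ) * (2 * π) ^ 3 * I * ξ 0 *
    ((ξ 0 : ℂ) ^ 2 + (ξ 1 : ℂ) ^ 2 + (ξ 2 : ℂ) ^ 2)) * Complex.I_sq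

variable {s q : ℝ} {z : ℂ}

theorem norm_cmultiplier : ‖cmultiplier s z q‖ =
    Real.exp (-(s * (2 * π) ^ 3 * z.im * (3 * z.re ^ 2 - z.im ^ 2 + q))) := by
  have hre : (I * z * (z ^ 2 + q)).re = -(z.im * (3 * z.re ^ 2 - z.im ^ 2 + q)) := by
    simp [sq]
    ring
  have hmul : (s * (2 * π) ^ 3 * I * z * (z ^ 2 + q) : ℂ) =
      ((s * (2 * π) ^ 3 : ℝ) : ℂ) * (I * z * (z ^ 2 + q)) := by
    push_cast
    ring
  rw [cmultiplier, Complex.norm_exp, hmul, Complex.re_ofReal_mul, hre]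
  ring_nf

theorem norm_cmultiplier_le (hz : |2 * π * z.im| ≤ 1) (hq : 0 ≤ q) (hs : 0 ≤ s * z.im) :
    ‖cmultiplier s z q‖ ≤
      Real.exp |s| * Real.exp (-(s * (2 * π * z.im) * (z.re ^ 2 + q))) := by
  have hs' : 0 ≤ s * (2 * π * z.im) := by
    have := mul_nonneg Real.two_pi_pos.le hs
    linarith
  have hcubic : s * (2 * π * z.im) * (2 * π * z.im) ^ 2 ≤ |s| := by
    rw [mul_assoc, ← pow_succ']
    calc s * (2 * π * z.im) ^ 3 ≤ |s * (2 * π * z.im) ^ 3| := le_abs_self _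
      _ = |s| * |2 * π * z.im| ^ 3 := by rw [abs_mul, abs_pow]
      _ ≤ |s| * 1 ^ 3 := by gcongr
      _ = |s| := by ring
  have hquadratic : s * (2 * π * z.im) * (1 * (z.re ^ 2 + q)) ≤
      s * (2 * π * z.im) * ((2 * π) ^ 2 * (3 * z.re ^ 2 + q)) := by
    gcongr
    · nlinarith [Real.pi_gt_three]
    · nlinarith [sq_nonneg z.re]
  rw [norm_cmultiplier, ← Real.exp_add, Real.exp_le_exp]
  linarith

end Multiplier

section ShiftedTransform

/-- The Fourier transform of `W(s) φ`, as a function of the complexified first frequency `z` and of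
`q = ξ₁² + ξ₂²`. -/
noncomputable def evolvedHat (s : ℝ) (z : ℂ) (q : ℝ) : ℂ := cmultiplier s z q * phiHat z q

/-- The Fourier transform of `e^{κx} W(s) φ`. -/
noncomputable def shiftedHat (s κ : ℝ) (ξ : R3) : ℂ :=
  evolvedHat s (ξ 0 + ↑(κ / (2 * π)) * I) (ξ 1 ^ 2 + ξ 2 ^ 2)

theorem norm_evolvedHat_le {s q : ℝ} {z : ℂ} (hz : |2 * π * z.im| ≤ 1) (hq : 0 ≤ q)
    (hs : 0 ≤ s * z.im) :
    ‖evolvedHat s z q‖ ≤ 2 * π * Real.exp |s| *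
      (Real.exp (-(s * (2 * π * z.im) * (z.re ^ 2 + q))) * ((1 + (z.re ^ 2 + q)) ^ 2)⁻¹) := by
  rw [evolvedHat, norm_mul]
  calc _ ≤ _ := mul_le_mul (norm_cmultiplier_le hz hq hs) (norm_phiHat_le hz hq) (norm_nonneg _)
        (by positivity)
    _ = _ := by ring

theorem differentiableAt_evolvedHat (s : ℝ) {q : ℝ} {z : ℂ} (hz : |2 * π * z.im| ≤ 1)
    (hq : 0 ≤ q) : DifferentiableAt ℂ (fun z => evolvedHat s z q) z := by
  unfold evolvedHat cmultiplier phiHat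
  exact .mul (by fun_prop) (.div (by fun_prop) (by fun_prop)
    (pow_ne_zero 2 (one_add_pi_sq_mul_ne_zero hz hq)))

theorem integrable_inv_one_add_norm_sq_sq :
    Integrable fun ξ : R3 => ((1 + ‖ξ‖ ^ 2) ^ 2)⁻¹ := by
  refine (integrable_rpow_neg_one_add_norm_sq (E := R3) (r := 4) (by simp; norm_num)).congr
    (.of_forall fun ξ => ?_)
  have : (0 : ℝ) ≤ 1 + ‖ξ‖ ^ 2 := by positivity
  norm_num [Real.rpow_neg this]

variable {s κ : ℝ}

theorem two_pi_mul_im_add_mul_I (x κ : ℝ) : 2 * π * (x + ↑(κ / (2 * π)) * I : ℂ).im = κ := by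
  simp only [Complex.add_im, Complex.ofReal_im, zero_add, Complex.im_ofReal_mul, Complex.I_im,
    mul_one]
  field_simp

theorem continuous_shiftedHat (s : ℝ) (hκ : |κ| ≤ 1) : Continuous (shiftedHat s κ) := by
  unfold shiftedHat evolvedHat cmultiplier phiHat
  refine .mul (by fun_prop) (.div (by fun_prop) (by fun_prop) fun ξ => pow_ne_zero 2 ?_)
  exact one_add_pi_sq_mul_ne_zero (by rwa [two_pi_mul_im_add_mul_I]) (by positivity)

theorem norm_shiftedHat_le (hκ : |κ| ≤ 1) (hs : 0 ≤ s * κ) (ξ : R3) :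
    ‖shiftedHat s κ ξ‖ ≤ 2 * π * Real.exp |s| *
      (Real.exp (-(s * κ * ‖ξ‖ ^ 2)) * ((1 + ‖ξ‖ ^ 2) ^ 2)⁻¹) := by
  have him := two_pi_mul_im_add_mul_I (ξ 0) κ
  have hre : (ξ 0 + ↑(κ / (2 * π)) * I : ℂ).re = ξ 0 := by simp [-Complex.ofReal_div]
  have hsim : 0 ≤ s * (ξ 0 + ↑(κ / (2 * π)) * I : ℂ).im := by
    rwa [← mul_nonneg_iff_of_pos_left Real.two_pi_pos, mul_left_comm, him]
  have := norm_evolvedHat_le (q := ξ 1 ^ 2 + ξ 2 ^ 2) (him.symm ▸ hκ) (by positivity) hsim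
  rwa [him, hre, ← norm_sq_eq_coords] at this

theorem norm_shiftedHat_le' (hκ : |κ| ≤ 1) (hs : 0 ≤ s * κ) (ξ : R3) :
    ‖shiftedHat s κ ξ‖ ≤ 2 * π * Real.exp |s| * ((1 + ‖ξ‖ ^ 2) ^ 2)⁻¹ := by
  refine (norm_shiftedHat_le hκ hs ξ).trans ?_
  gcongr
  exact mul_le_of_le_one_left (by positivity)
    (Real.exp_le_one_iff.2 (neg_nonpos.2 (by positivity)))

theorem integrable_shiftedHat (hκ : |κ| ≤ 1) (hs : 0 ≤ s * κ) : Integrable (shiftedHat s κ) :=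
  (integrable_inv_one_add_norm_sq_sq.const_mul _).mono'
    (continuous_shiftedHat s hκ).aestronglyMeasurable (.of_forall (norm_shiftedHat_le' hκ hs))

end ShiftedTransform

section Smoothing

/-- The continuous representative of `W(s) φ`. -/
noncomputable def evolved (s : ℝ) : R3 → ℂ := 𝓕⁻ (shiftedHat s 0)

theorem shiftedHat_zero (s : ℝ) :
    shiftedHat s 0 = fun ξ : R3 => evolvedHat s (ξ 0) (ξ 1 ^ 2 + ξ 2 ^ 2) := by
  ext ξ
  simp [shiftedHat]

theorem norm_evolved_le (s : ℝ) (v : R3) : ‖evolved s v‖ ≤ ∫ ξ, ‖shiftedHat 0 0 ξ‖ := by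
  refine (norm_fourierInv_le_integral_norm _ v).trans_eq
    (integral_congr_ae (.of_forall fun ξ => ?_))
  simp [shiftedHat_zero, evolvedHat, norm_cmultiplier]

theorem evolved_zero (v : R3) : evolved 0 v = phiFun v := by
  have hhat : shiftedHat 0 0 = fun ξ : R3 => phiHat (ξ 0) (ξ 1 ^ 2 + ξ 2 ^ 2) := by
    simp [shiftedHat_zero, evolvedHat, cmultiplier]
  rw [evolved, hhat, fourierInv_phiHat]
  exact hhat ▸ integrable_shiftedHat (by simp) (by simp)

variable {s κ : ℝ}

theorem abs_le_one_and_mul_nonneg_of_mem_uIcc (hκ : |κ| ≤ 1) (hs : 0 ≤ s * κ) {y : ℝ}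
    (hy : y ∈ Set.uIcc 0 (κ / (2 * π))) : |2 * π * y| ≤ 1 ∧ 0 ≤ s * y := by
  have hscale : 2 * π * y ∈ Set.uIcc 0 κ := by
    have := Set.mem_image_of_mem (2 * π * ·) hy
    rwa [Set.image_const_mul_uIcc, mul_zero, mul_div_cancel₀ _ Real.two_pi_pos.ne'] at this
  refine ⟨(by simpa using Set.abs_sub_left_of_mem_uIcc hscale : |2 * π * y| ≤ |κ|).trans hκ, ?_⟩
  have := Set.mem_image_of_mem (s * ·) hscale
  rw [Set.image_const_mul_uIcc, mul_zero, Set.uIcc_of_le hs, mul_left_comm] at this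
  exact nonneg_of_mul_nonneg_right this.1 Real.two_pi_pos

theorem norm_evolvedHat_le_of_mem_uIcc (hκ : |κ| ≤ 1) (hs : 0 ≤ s * κ) {q : ℝ} (hq : 0 ≤ q)
    (x : ℝ) {y : ℝ} (hy : y ∈ Set.uIcc 0 (κ / (2 * π))) :
    ‖evolvedHat s (x + y * I) q‖ ≤ 2 * π * Real.exp |s| * (1 + x ^ 2)⁻¹ := by
  have hre : (x + y * I : ℂ).re = x := by simp
  have him : (x + y * I : ℂ).im = y := by simp
  obtain ⟨hy₁, hsy⟩ := abs_le_one_and_mul_nonneg_of_mem_uIcc hκ hs hy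
  refine (norm_evolvedHat_le (by rwa [him]) hq (by rwa [him])).trans ?_
  rw [hre, him]
  have hexp : Real.exp (-(s * (2 * π * y) * (x ^ 2 + q))) ≤ 1 := by
    rw [Real.exp_le_one_iff, neg_nonpos, mul_left_comm s]
    positivity
  have hinv : ((1 + (x ^ 2 + q)) ^ 2)⁻¹ ≤ (1 + x ^ 2)⁻¹ := by
    gcongr
    nlinarith [sq_nonneg x]
  gcongr
  exact (mul_le_of_le_one_left (by positivity) hexp).trans hinv

theorem evolved_eq_exp_mul_fourierInv (hκ : |κ| ≤ 1) (hs : 0 ≤ s * κ) (v : R3) :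
    evolved s v = Complex.exp (-(κ * v 0)) * 𝓕⁻ (shiftedHat s κ) v := by
  have hB : Tendsto (fun x : ℝ => 2 * π * Real.exp |s| * (1 + x ^ 2)⁻¹) (cocompact ℝ) (𝓝 0) := by
    have hsq : Tendsto (fun x : ℝ => x ^ 2) (cocompact ℝ) atTop := by
      simpa only [Function.comp_def, Real.norm_eq_abs, sq_abs] using
        (tendsto_pow_atTop two_ne_zero).comp (tendsto_norm_cocompact_atTop (E := ℝ))
    simpa using (tendsto_inv_atTop_zero.comp
      (tendsto_atTop_add_const_left _ 1 hsq)).const_mul (2 * π * Real.exp |s|)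
  have hint : Integrable fun ξ : R3 => evolvedHat s (ξ 0) (ξ 1 ^ 2 + ξ 2 ^ 2) :=
    shiftedHat_zero s ▸ integrable_shiftedHat (by simp) (by simp)
  have hshift := fourierInv_eq_exp_smul_fourierInv_shift
    (G := fun z p => evolvedHat s z (p.1 ^ 2 + p.2 ^ 2)) (β := κ / (2 * π))
    (fun p z hz => (differentiableAt_evolvedHat s
      (abs_le_one_and_mul_nonneg_of_mem_uIcc hκ hs hz).1 (by positivity)).differentiableWithinAt)
    (fun p x y hy => norm_evolvedHat_le_of_mem_uIcc hκ hs (by positivity) x hy) hB hint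
    (integrable_shiftedHat hκ hs) v
  have hβ : (2 * π * ↑(κ / (2 * π)) * v 0 : ℂ) = κ * v 0 := by
    push_cast
    field_simp
  rwa [hβ, ← shiftedHat_zero] at hshift

theorem norm_pow_mul_norm_shiftedHat_le (hκ : |κ| = 1) (hs : 0 < s * κ) (k : ℕ) (ξ : R3) :
    ‖ξ‖ ^ k * ‖shiftedHat s κ ξ‖ ≤
      2 * π * k.factorial * (Real.exp (2 * |s|) * |s|⁻¹ ^ k) * ((1 + ‖ξ‖ ^ 2) ^ 2)⁻¹ := by
  have habs : s * κ = |s| := by rw [← abs_of_pos hs, abs_mul, hκ, mul_one]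
  have hs' : 0 < |s| := habs ▸ hs
  have hpow : ‖ξ‖ ^ k ≤ k.factorial * Real.exp (|s| * (1 + ‖ξ‖ ^ 2)) * |s|⁻¹ ^ k := by
    have hexp := Real.pow_div_factorial_le_exp (|s| * (1 + ‖ξ‖ ^ 2)) (by positivity) k
    rw [div_le_iff₀ (by positivity), mul_pow] at hexp
    calc ‖ξ‖ ^ k ≤ (1 + ‖ξ‖ ^ 2) ^ k := by
          gcongr
          nlinarith [sq_nonneg (‖ξ‖ - 1)]
      _ = |s| ^ k * (1 + ‖ξ‖ ^ 2) ^ k * |s|⁻¹ ^ k := by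
          rw [inv_pow]
          field_simp
      _ ≤ Real.exp (|s| * (1 + ‖ξ‖ ^ 2)) * k.factorial * |s|⁻¹ ^ k := by gcongr
      _ = _ := by ring
  calc ‖ξ‖ ^ k * ‖shiftedHat s κ ξ‖
      ≤ k.factorial * Real.exp (|s| * (1 + ‖ξ‖ ^ 2)) * |s|⁻¹ ^ k * (2 * π * Real.exp |s| *
          (Real.exp (-(s * κ * ‖ξ‖ ^ 2)) * ((1 + ‖ξ‖ ^ 2) ^ 2)⁻¹)) :=
        mul_le_mul hpow (norm_shiftedHat_le hκ.le hs.le ξ) (norm_nonneg _) (by positivity)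
    _ = 2 * π * k.factorial * (Real.exp (|s| * (1 + ‖ξ‖ ^ 2) + |s| + -(s * κ * ‖ξ‖ ^ 2)) *
          |s|⁻¹ ^ k) * ((1 + ‖ξ‖ ^ 2) ^ 2)⁻¹ := by
        rw [Real.exp_add, Real.exp_add]
        ring
    _ = _ := by
        rw [habs]
        ring_nf

theorem integrable_norm_pow_mul_norm_shiftedHat (hκ : |κ| = 1) (hs : 0 < s * κ) (k : ℕ) :
    Integrable fun ξ => ‖ξ‖ ^ k * ‖shiftedHat s κ ξ‖ := by
  refine (integrable_inv_one_add_norm_sq_sq.const_mul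
    (2 * π * k.factorial * (Real.exp (2 * |s|) * |s|⁻¹ ^ k))).mono'
    ((continuous_norm.pow k).mul (continuous_shiftedHat s hκ.le).norm).aestronglyMeasurable
    (.of_forall fun ξ => ?_)
  rw [Real.norm_of_nonneg (by positivity)]
  exact norm_pow_mul_norm_shiftedHat_le hκ hs k ξ

/-- The constant in the bound for the derivatives of order `k` of `e^{κx} W(s) φ`. -/
noncomputable def derivConst (k : ℕ) : ℝ :=
  (2 * π) ^ k * (2 * π * k.factorial * ∫ ξ : R3, ((1 + ‖ξ‖ ^ 2) ^ 2)⁻¹)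

theorem contDiff_fourierInv_shiftedHat (hκ : |κ| = 1) (hs : 0 < s * κ) :
    ContDiff ℝ ∞ (𝓕⁻ (shiftedHat s κ)) :=
  contDiff_fourierInv (integrable_norm_pow_mul_norm_shiftedHat hκ hs)

theorem norm_iteratedFDeriv_fourierInv_shiftedHat_le (hκ : |κ| = 1) (hs : 0 < s * κ) (k : ℕ)
    (v : R3) :
    ‖iteratedFDeriv ℝ k (𝓕⁻ (shiftedHat s κ)) v‖ ≤
      derivConst k * (Real.exp (2 * |s|) * |s|⁻¹ ^ k) := by
  have hint := integrable_norm_pow_mul_norm_shiftedHat hκ hs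
  calc ‖iteratedFDeriv ℝ k (𝓕⁻ (shiftedHat s κ)) v‖
      ≤ (2 * π) ^ k * ∫ ξ, ‖ξ‖ ^ k * ‖shiftedHat s κ ξ‖ :=
        norm_iteratedFDeriv_fourierInv_le hint
          (continuous_shiftedHat s hκ.le).aestronglyMeasurable k v
    _ ≤ (2 * π) ^ k * ∫ ξ : R3, 2 * π * k.factorial * (Real.exp (2 * |s|) * |s|⁻¹ ^ k) *
          ((1 + ‖ξ‖ ^ 2) ^ 2)⁻¹ := by
        gcongr ?_ * ?_
        exact integral_mono (hint k) (integrable_inv_one_add_norm_sq_sq.const_mul _)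
          (norm_pow_mul_norm_shiftedHat_le hκ hs k)
    _ = derivConst k * (Real.exp (2 * |s|) * |s|⁻¹ ^ k) := by
        rw [integral_const_mul, derivConst]
        ring

end Smoothing

section Series

variable {ι : Type*} {c : ι → ℂ} {s : ι → ℝ}

theorem summable_mul_evolved (hc : Summable fun i => ‖c i‖) (v : R3) :
    Summable fun i => c i * evolved (s i) v :=
  .of_norm_bounded (hc.mul_right _) fun _ =>
    (norm_mul _ _).trans_le (mul_le_mul_of_nonneg_left (norm_evolved_le _ _) (norm_nonneg _))

theorem contDiff_tsum_mul_evolved_of_mul_pos {κ : ℝ} (hκ : |κ| = 1) (hsκ : ∀ i, 0 < s i * κ)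
    (hcs : ∀ m : ℕ, Summable fun i => ‖c i‖ * (Real.exp (2 * |s i|) * |s i|⁻¹ ^ m)) :
    ContDiff ℝ ∞ fun v => ∑' i, c i * evolved (s i) v := by
  simp_rw [fun i => evolved_eq_exp_mul_fourierInv hκ.le (hsκ i).le, mul_left_comm (c _),
    tsum_mul_left]
  have hweight : ContDiff ℝ ∞ fun v : R3 => Complex.exp (-(κ * v 0)) :=
    ((contDiff_const.mul (Complex.ofRealCLM.contDiff.comp (by fun_prop))).neg).cexp
  refine hweight.mul (contDiff_tsum
    (fun i => contDiff_const.mul (contDiff_fourierInv_shiftedHat hκ (hsκ i)))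
    (fun m _ => (hcs m).mul_left (derivConst m)) fun m i v _ => ?_)
  have hsmooth := (contDiff_fourierInv_shiftedHat hκ (hsκ i)).of_le
    (show (m : ℕ∞ω) ≤ ∞ by exact_mod_cast le_top)
  calc ‖iteratedFDeriv ℝ m (fun v => c i • 𝓕⁻ (shiftedHat (s i) κ) v) v‖
      = ‖c i‖ * ‖iteratedFDeriv ℝ m (𝓕⁻ (shiftedHat (s i) κ)) v‖ := by
        rw [iteratedFDeriv_const_smul_apply' hsmooth.contDiffAt, norm_smul]
    _ ≤ ‖c i‖ * (derivConst m * (Real.exp (2 * |s i|) * |s i|⁻¹ ^ m)) := by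
        gcongr
        exact norm_iteratedFDeriv_fourierInv_shiftedHat_le hκ (hsκ i) m v
    _ = derivConst m * (‖c i‖ * (Real.exp (2 * |s i|) * |s i|⁻¹ ^ m)) := by ring

theorem contDiff_tsum_mul_evolved (hs : ∀ i, s i ≠ 0)
    (hcs : ∀ m : ℕ, Summable fun i => ‖c i‖ * (Real.exp (2 * |s i|) * |s i|⁻¹ ^ m)) :
    ContDiff ℝ ∞ fun v => ∑' i, c i * evolved (s i) v := by
  have hc : Summable fun i => ‖c i‖ := .of_nonneg_of_le (fun _ => norm_nonneg _)
    (fun _ => le_mul_of_one_le_right (norm_nonneg _) (by simp)) (hcs 0)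
  simp_rw [← fun v => (summable_mul_evolved (s := s) hc v).tsum_subtype_add_tsum_subtype_compl
    {i | 0 < s i}]
  refine .add (contDiff_tsum_mul_evolved_of_mul_pos (κ := 1) (by simp) (fun i => ?_)
      fun m => (hcs m).subtype _)
    (contDiff_tsum_mul_evolved_of_mul_pos (κ := -1) (by simp) (fun i => ?_)
      fun m => (hcs m).subtype _)
  · rw [mul_one]
    exact i.2
  · rw [mul_neg_one, neg_pos]
    exact (not_lt.1 (Set.notMem_ofPred_iff.1 i.2)).lt_of_ne (hs i)

end Series

section Propagator

theorem multiplier_add (s t : ℝ) (ξ : R3) :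
    multiplier (s + t) ξ = multiplier s ξ * multiplier t ξ := by
  rw [multiplier, multiplier, multiplier, ← Complex.exp_add]
  congr 1
  push_cast
  ring

theorem W_W (s t : ℝ) (f : L2) : W s (W t f) = W (s + t) f := by
  rw [W, W]
  congr 1
  rw [MemLp.toLp_eq_toLp_iff, FourierTransform.fourier_fourierInv_eq]
  filter_upwards [(memLp_multiplier_mul t (𝓕 f)).coeFn_toLp] with ξ hξ
  rw [hξ, multiplier_add, mul_assoc]

theorem W_zero (f : L2) : W 0 f = f := by
  have : ((memLp_multiplier_mul 0 (𝓕 f)).toLp _ : L2) = 𝓕 f := by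
    rw [Lp.ext_iff]
    exact (MemLp.coeFn_toLp _).trans (.of_forall fun ξ => by simp [multiplier])
  rw [W, this, FourierTransform.fourierInv_fourier_eq]

/-- The propagator `W(t)` as a linear isometry of `L²(ℝ³)`. -/
noncomputable def WIsometry (t : ℝ) : L2 →ₗᵢ[ℂ] L2 where
  toFun := W t
  map_add' f g := by
    rw [W, W, W, ← FourierTransform.fourierInv_add, ← MemLp.toLp_add]
    congr 1
    rw [MemLp.toLp_eq_toLp_iff, FourierTransform.fourier_add]
    filter_upwards [Lp.coeFn_add (𝓕 f) (𝓕 g)] with ξ hξ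
    rw [hξ, Pi.add_apply, Pi.add_apply, mul_add]
  map_smul' c f := by
    rw [W, W, RingHom.id_apply, ← FourierTransform.fourierInv_smul, ← MemLp.toLp_const_smul]
    congr 1
    rw [MemLp.toLp_eq_toLp_iff, FourierTransform.fourier_smul]
    filter_upwards [Lp.coeFn_smul c (𝓕 f)] with ξ hξ
    rw [hξ, Pi.smul_apply, Pi.smul_apply, mul_smul_comm]
  norm_map' f := by
    change ‖W t f‖ = ‖f‖
    rw [← Lp.norm_fourier_eq (W t f), W, FourierTransform.fourier_fourierInv_eq,
      ← Lp.norm_fourier_eq f, Lp.norm_toLp, Lp.norm_def]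
    congr 1
    exact eLpNorm_congr_norm_ae (.of_forall fun ξ => by simp [norm_multiplier])

theorem norm_W (t : ℝ) (f : L2) : ‖W t f‖ = ‖f‖ := (WIsometry t).norm_map f

theorem W_smul (t : ℝ) (c : ℂ) (f : L2) : W t (c • f) = c • W t f := (WIsometry t).map_smul c f

theorem hasSum_W {ι : Type*} {F : ι → L2} (t : ℝ) (hF : Summable F) :
    HasSum (fun i => W t (F i)) (W t (∑' i, F i)) :=
  (WIsometry t).toContinuousLinearMap.hasSum hF.hasSum

theorem memLp_two_shiftedHat_zero (s : ℝ) : MemLp (shiftedHat s 0) 2 volume := by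
  have hcont := continuous_shiftedHat s (κ := 0) (by simp)
  rw [memLp_two_iff_integrable_sq_norm hcont.aestronglyMeasurable]
  refine (integrable_inv_one_add_norm_sq_sq.const_mul ((2 * π * Real.exp |s|) ^ 2)).mono'
    (hcont.norm.pow 2).aestronglyMeasurable (.of_forall fun ξ => ?_)
  have hle_one : ((1 + ‖ξ‖ ^ 2) ^ 2)⁻¹ ≤ 1 :=
    inv_le_one_of_one_le₀ (one_le_pow₀ (by linarith [sq_nonneg ‖ξ‖]))
  calc ‖‖shiftedHat s 0 ξ‖ ^ 2‖
      ≤ (2 * π * Real.exp |s| * ((1 + ‖ξ‖ ^ 2) ^ 2)⁻¹) ^ 2 := by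
        rw [Real.norm_of_nonneg (by positivity)]
        gcongr
        exact norm_shiftedHat_le' (by simp) (by simp) ξ
    _ ≤ (2 * π * Real.exp |s|) ^ 2 * ((1 + ‖ξ‖ ^ 2) ^ 2)⁻¹ := by
        rw [mul_pow]
        gcongr
        exact pow_le_of_le_one (by positivity) hle_one two_ne_zero

theorem integrable_shiftedHat_zero (s : ℝ) : Integrable (shiftedHat s 0) :=
  integrable_shiftedHat (by simp) (by simp)

theorem phi_eq_fourierInv : phi = 𝓕⁻ ((memLp_two_shiftedHat_zero 0).toLp _ : L2) := by
  rw [Lp.ext_iff]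
  filter_upwards [memLp_phiFun.coeFn_toLp,
    fourierInv_toLp_ae_eq (integrable_shiftedHat_zero 0) (memLp_two_shiftedHat_zero 0)] with v h₁ h₂
  rw [phi, h₁, h₂, ← evolved_zero, evolved]

theorem multiplier_mul_shiftedHat_zero (s : ℝ) (ξ : R3) :
    multiplier s ξ * shiftedHat 0 0 ξ = shiftedHat s 0 ξ := by
  simp [shiftedHat_zero, evolvedHat, multiplier_eq_cmultiplier, cmultiplier]

theorem W_phi_ae_eq (s : ℝ) : W s phi =ᵐ[volume] evolved s := by
  have hW : W s phi = 𝓕⁻ ((memLp_two_shiftedHat_zero s).toLp _ : L2) := by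
    rw [W]
    congr 1
    rw [MemLp.toLp_eq_toLp_iff, phi_eq_fourierInv, FourierTransform.fourier_fourierInv_eq]
    filter_upwards [(memLp_two_shiftedHat_zero 0).coeFn_toLp] with ξ hξ
    rw [hξ, multiplier_mul_shiftedHat_zero]
  rw [hW]
  exact fourierInv_toLp_ae_eq (integrable_shiftedHat_zero s) (memLp_two_shiftedHat_zero s)

end Propagator

section InitialDatum

/-- The weight `e^{-e^k} e^{-j²}` of the term belonging to the pair `(k, j)`. -/
noncomputable def coeff (p : CoprimePair) : ℝ :=
  Real.exp (-Real.exp (p.1.1 : ℝ)) * Real.exp (-(p.1.2 : ℝ) ^ 2)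

/-- The time `t - j / k` elapsed, at time `t`, since the term belonging to `(k, j)` was a multiple
of `φ`. -/
noncomputable def elapsed (t : ℝ) (p : CoprimePair) : ℝ := t - (p.1.2 : ℝ) / (p.1.1 : ℝ)

theorem coeff_pos (p : CoprimePair) : 0 < coeff p := by
  unfold coeff
  positivity

theorem norm_coeff (p : CoprimePair) : ‖(coeff p : ℂ)‖ = coeff p :=
  Complex.norm_of_nonneg (coeff_pos p).le

theorem term_eq (p : CoprimePair) : term p = (coeff p : ℂ) • W (elapsed 0 p) phi := by
  rw [term, coeff, elapsed, zero_sub]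

theorem W_term (t : ℝ) (p : CoprimePair) :
    W t (term p) = (coeff p : ℂ) • W (elapsed t p) phi := by
  rw [term_eq, W_smul, W_W, elapsed, elapsed, zero_sub, sub_eq_add_neg]

theorem summable_exp_neg_exp_mul_pow (n : ℕ) :
    Summable fun k : ℕ => Real.exp (-Real.exp k) * (k : ℝ) ^ n := by
  refine .of_nonneg_of_le (fun k => by positivity) (fun k => ?_)
    (Real.summable_pow_mul_exp_neg_nat_mul n one_pos)
  rw [mul_comm]
  gcongr
  linarith [Real.add_one_le_exp (k : ℝ)]

theorem summable_exp_neg_sq_mul_exp :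
    Summable fun j : ℕ => Real.exp (-(j : ℝ) ^ 2) * Real.exp (2 * j) := by
  refine .of_nonneg_of_le (fun j => by positivity) (fun j => ?_)
    (Real.summable_exp_neg_nat.mul_left (Real.exp (9 / 4)))
  rw [← Real.exp_add, ← Real.exp_add, Real.exp_le_exp]
  nlinarith [sq_nonneg ((j : ℝ) - 3 / 2)]

theorem summable_coeff_mul_exp_mul_pow (n : ℕ) :
    Summable fun p : CoprimePair => coeff p * (Real.exp (2 * p.1.2) * (p.1.1 : ℝ) ^ n) := by
  have hprod := (summable_exp_neg_exp_mul_pow n).mul_of_nonneg summable_exp_neg_sq_mul_exp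
    (fun k => by positivity) (fun j => by positivity)
  refine (hprod.comp_injective ((PNat.coe_injective.prodMap PNat.coe_injective).comp
    Subtype.val_injective)).congr fun p => ?_
  simp only [Function.comp_apply, Prod.map, coeff]
  ring

theorem summable_norm_coeff : Summable fun p => ‖(coeff p : ℂ)‖ := by
  simp_rw [norm_coeff]
  refine .of_nonneg_of_le (fun p => (coeff_pos p).le) (fun p => ?_)
    (summable_coeff_mul_exp_mul_pow 0)
  rw [pow_zero, mul_one]
  exact le_mul_of_one_le_right (coeff_pos p).le (Real.one_le_exp (by positivity))

theorem summable_term : Summable term :=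
  .of_norm_bounded (summable_norm_coeff.mul_right ‖phi‖) fun p => by
    rw [term_eq, norm_smul, norm_W]

theorem W_u0_ae_eq (t : ℝ) :
    W t u0 =ᵐ[volume] fun v => ∑' p, (coeff p : ℂ) * evolved (elapsed t p) v := by
  have hsum := hasSum_W t summable_term
  rw [u0, ← hsum.tsum_eq]
  refine tsum_ae_eq_of_hasSum hsum.summable (fun p => ?_)
    fun v => (summable_mul_evolved summable_norm_coeff v).hasSum
  rw [W_term]
  filter_upwards [Lp.coeFn_smul (coeff p : ℂ) (W (elapsed t p) phi), W_phi_ae_eq (elapsed t p)]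
    with v hsmul hphi
  rw [hsmul, Pi.smul_apply, hphi, smul_eq_mul]

/-- The pairs `(k, j)` with `j / k = t`, whose terms are multiples of `φ` at time `t`. -/
def resonant (t : ℝ) : Set CoprimePair := {p | elapsed t p = 0}

/-- The contribution to `W(t) u₀` of the terms that have been smoothed out by time `t`. -/
noncomputable def regularPart (t : ℝ) (v : R3) : ℂ :=
  ∑' p : ↥(resonant t)ᶜ, (coeff p : ℂ) * evolved (elapsed t p) v

/-- The factor of `φ` in the contribution of the resonant terms to `W(t) u₀`. -/
noncomputable def resonantWeight (t : ℝ) : ℝ := ∑' p : resonant t, coeff p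

theorem W_u0_ae_eq_regularPart_add (t : ℝ) :
    W t u0 =ᵐ[volume] fun v => regularPart t v + resonantWeight t * phiFun v := by
  refine (W_u0_ae_eq t).trans (.of_forall fun v => ?_)
  have hresonant (p : resonant t) : evolved (elapsed t p) v = phiFun v := by
    rw [p.2, evolved_zero]
  beta_reduce
  rw [← (summable_mul_evolved summable_norm_coeff v).tsum_subtype_add_tsum_subtype_compl
    (resonant t), add_comm, regularPart, resonantWeight, Complex.ofReal_tsum, ← tsum_mul_right]
  simp_rw [hresonant]

/-- `t` is at distance at least `c / k ^ n` from all the positive fractions `j / k` different from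
`t`, for some `c > 0` and some `n`. -/
def IsDiophantine (t : ℝ) : Prop :=
  ∃ c > 0, ∃ n : ℕ, ∀ j k : ℕ+, t ≠ j / k → c / (k : ℝ) ^ n ≤ |t - j / k|

theorem abs_elapsed_le (t : ℝ) (p : CoprimePair) : |elapsed t p| ≤ |t| + p.1.2 := by
  refine (abs_sub _ _).trans ?_
  gcongr
  rw [abs_of_nonneg (by positivity)]
  exact div_le_self (by positivity) (mod_cast p.1.1.pos)

theorem IsDiophantine.exists_inv_abs_elapsed_le {t : ℝ} (ht : IsDiophantine t) :
    ∃ C ≥ 0, ∃ n : ℕ, ∀ p, |elapsed t p|⁻¹ ≤ C * (p.1.1 : ℝ) ^ n := by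
  obtain ⟨c, hc, n, h⟩ := ht
  refine ⟨c⁻¹, by positivity, n, fun p => ?_⟩
  by_cases h₀ : elapsed t p = 0
  · rw [h₀, abs_zero, inv_zero]
    positivity
  · have : (0 : ℝ) < p.1.1 := mod_cast p.1.1.pos
    refine (inv_anti₀ (by positivity) (h p.1.2 p.1.1 (sub_ne_zero.1 h₀))).trans_eq ?_
    rw [inv_div, div_eq_inv_mul]

theorem IsDiophantine.summable_coeff_mul_inv_pow {t : ℝ} (ht : IsDiophantine t) (m : ℕ) :
    Summable fun p =>
      ‖(coeff p : ℂ)‖ * (Real.exp (2 * |elapsed t p|) * |elapsed t p|⁻¹ ^ m) := by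
  obtain ⟨C, _, n, h⟩ := ht.exists_inv_abs_elapsed_le
  refine .of_nonneg_of_le (fun p => by positivity) (fun p => ?_)
    ((summable_coeff_mul_exp_mul_pow (n * m)).mul_left (Real.exp (2 * |t|) * C ^ m))
  have hexp : Real.exp (2 * |elapsed t p|) ≤ Real.exp (2 * |t|) * Real.exp (2 * p.1.2) := by
    rw [← Real.exp_add, ← mul_add]
    gcongr
    exact abs_elapsed_le t p
  have := (coeff_pos p).le
  calc ‖(coeff p : ℂ)‖ * (Real.exp (2 * |elapsed t p|) * |elapsed t p|⁻¹ ^ m)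
      ≤ coeff p * ((Real.exp (2 * |t|) * Real.exp (2 * p.1.2)) * (C * (p.1.1 : ℝ) ^ n) ^ m) := by
        rw [norm_coeff]
        gcongr
        exact h p
    _ = Real.exp (2 * |t|) * C ^ m * (coeff p * (Real.exp (2 * p.1.2) * p.1.1 ^ (n * m))) := by
        rw [mul_pow, pow_mul]
        ring

variable {t : ℝ}

theorem contDiff_regularPart (ht : IsDiophantine t) : ContDiff ℝ ∞ (regularPart t) :=
  contDiff_tsum_mul_evolved (fun p => p.2) fun m => (ht.summable_coeff_mul_inv_pow m).subtype _

theorem isCnOn_univ_of_elapsed_ne_zero (ht : IsDiophantine t) (h₀ : ∀ p, elapsed t p ≠ 0) :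
    IsCnOn ⊤ (W t u0) Set.univ := by
  have : IsEmpty (resonant t) := ⟨fun p => h₀ p p.2⟩
  refine ⟨regularPart t, (contDiff_regularPart ht).contDiffOn, ae_restrict_of_ae ?_⟩
  filter_upwards [W_u0_ae_eq_regularPart_add t] with v hv
  simpa [resonantWeight] using hv

theorem contDiffAt_phiFun {v : R3} (hv : v ≠ 0) : ContDiffAt ℝ ∞ phiFun v :=
  Complex.ofRealCLM.contDiff.contDiffAt.comp v (contDiffAt_const.mul (contDiffAt_norm ℝ hv)).exp

theorem isCnOn_compl_zero (ht : IsDiophantine t) : IsCnOn ⊤ (W t u0) {0}ᶜ :=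
  ⟨fun v => regularPart t v + resonantWeight t * phiFun v,
    fun _ hv => ((contDiff_regularPart ht).contDiffAt.add
      (contDiffAt_const.mul (contDiffAt_phiFun hv))).contDiffWithinAt,
    ae_restrict_of_ae (W_u0_ae_eq_regularPart_add t)⟩

theorem continuous_phiFun : Continuous phiFun := by
  unfold phiFun
  fun_prop

theorem not_differentiable_phiFun : ¬ Differentiable ℝ phiFun := by
  intro hφ
  have hline : Differentiable ℝ fun x : ℝ => x • (EuclideanSpace.single 0 1 : R3) := by fun_prop
  have hexp : (fun x : ℝ => Real.exp (-2 * |x|)) =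
      Complex.reCLM ∘ phiFun ∘ fun x : ℝ => x • (EuclideanSpace.single 0 1 : R3) := by
    ext x
    simp [phiFun, norm_smul, -Complex.ofReal_exp]
  have hdiff : Differentiable ℝ fun x : ℝ => Real.exp (-2 * |x|) :=
    hexp ▸ Complex.reCLM.differentiable.comp (hφ.comp hline)
  have habs : DifferentiableAt ℝ (fun x : ℝ => -(1 / 2) * Real.log (Real.exp (-2 * |x|))) 0 :=
    ((hdiff 0).log (Real.exp_ne_zero _)).const_mul _
  refine not_differentiableAt_abs_zero (habs.congr_of_eventuallyEq (.of_forall fun x => ?_))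
  simp only [Real.log_exp]
  ring

theorem resonantWeight_pos {p : CoprimePair} (hp : elapsed t p = 0) : 0 < resonantWeight t := by
  have hsum : Summable coeff := by simpa only [norm_coeff] using summable_norm_coeff
  exact (hsum.subtype _).tsum_pos (fun p => (coeff_pos p).le) ⟨p, hp⟩ (coeff_pos p)

theorem not_isCnOn_one (ht : IsDiophantine t) {p : CoprimePair} (hp : elapsed t p = 0) :
    ¬ IsCnOn 1 (W t u0) Set.univ := by
  rintro ⟨g, hg, hWg⟩
  rw [Measure.restrict_univ] at hWg
  replace hg : ContDiff ℝ 1 g := contDiffOn_univ.1 hg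
  have hw : (resonantWeight t : ℂ) ≠ 0 := mod_cast (resonantWeight_pos hp).ne'
  have hR := contDiff_regularPart ht
  have hg_eq : (fun v => regularPart t v + resonantWeight t * phiFun v) = g :=
    (Continuous.ae_eq_iff_eq volume
      (hR.continuous.add (continuous_const.mul continuous_phiFun)) hg.continuous).1
      ((W_u0_ae_eq_regularPart_add t).symm.trans hWg)
  have hφ : phiFun = fun v => (resonantWeight t : ℂ)⁻¹ * (g v - regularPart t v) := by
    ext v
    rw [← hg_eq, add_sub_cancel_left, inv_mul_cancel_left₀ hw]
  refine not_differentiable_phiFun (hφ ▸ ?_)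
  exact ((hg.differentiable (by norm_num)).sub (hR.differentiable (by simp))).const_mul _

end InitialDatum

section Times

theorem isDiophantine_ratCast (q : ℚ) : IsDiophantine q := by
  refine ⟨(q.den : ℝ)⁻¹, by have := q.pos; positivity, 1, fun j k h => ?_⟩
  have hk : (0 : ℝ) < k := mod_cast k.pos
  have hd : (0 : ℝ) < q.den := mod_cast q.pos
  have hdiff : (q : ℝ) - j / k = (q.num * k - q.den * j : ℤ) / (q.den * k) := by
    rw [Rat.cast_def, div_sub_div _ _ hd.ne' hk.ne']
    push_cast
    rfl
  have hnum : (q.num * k - q.den * j : ℤ) ≠ 0 := fun h₀ => by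
    rw [h₀, Int.cast_zero, zero_div, sub_eq_zero] at hdiff
    exact h hdiff
  rw [hdiff, abs_div, abs_of_pos (mul_pos hd hk), pow_one, ← one_div, div_div]
  gcongr
  exact_mod_cast Int.one_le_abs hnum

theorem isDiophantine_of_nonpos {t : ℝ} (ht : t ≤ 0) : IsDiophantine t := by
  refine ⟨1, one_pos, 1, fun j k _ => ?_⟩
  have hj : (1 : ℝ) ≤ j := mod_cast j.pos
  calc 1 / (k : ℝ) ^ 1 ≤ j / k := by
        rw [pow_one]
        gcongr
    _ ≤ j / k - t := by linarith
    _ ≤ |t - j / k| := neg_sub t ((j : ℝ) / k) ▸ neg_le_abs _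

theorem isDiophantine_of_not_liouville {t : ℝ} (ht : ¬ Liouville t) : IsDiophantine t := by
  unfold Liouville at ht
  push Not at ht
  obtain ⟨n, hn⟩ := ht
  refine ⟨1 / 2 ^ n, by positivity, n, fun j k hjk => ?_⟩
  -- Liouville numbers are defined by denominators at least `2`, hence the unreduced fraction.
  have hfrac : ((2 * j : ℤ) : ℝ) / (2 * k : ℤ) = j / k := by
    push_cast
    exact mul_div_mul_left _ _ two_ne_zero
  have h := hn (2 * j) (2 * k) (by have := k.pos; omega) (hfrac ▸ hjk)
  rw [hfrac] at h
  push_cast at h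
  rwa [mul_pow, ← div_div] at h

theorem volume_setOf_not_isDiophantine : volume {t | ¬ IsDiophantine t} = 0 :=
  measure_mono_null (fun _ ht => not_imp_comm.1 isDiophantine_of_not_liouville ht)
    volume_setOfPred_liouville

theorem IsGeneric.exists_div_sq_le {γ : ℝ} (hγ : IsGeneric γ) :
    ∃ c > 0, ∀ j k : ℕ+, c / (j + k : ℝ) ^ 2 ≤ k * |γ - j / k| := by
  obtain ⟨-, c, hc, h⟩ := hγ
  refine ⟨c, hc, fun j k => ?_⟩
  have hj : (1 : ℝ) ≤ j := mod_cast j.pos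
  have hk : (1 : ℝ) ≤ k := mod_cast k.pos
  have hcast : ((|-(j : ℤ)| + |(k : ℤ)| : ℤ) : ℝ) = j + k := by simp
  have hK := h (-j) k (by
    rw [abs_neg, Nat.abs_cast, Nat.abs_cast]
    have := j.pos
    have := k.pos
    omega)
  have hlog : Real.log (j + k) ≤ j + k := (Real.log_le_sub_one_of_pos (by linarith)).trans (by simp)
  have hlog_pos : 0 < Real.log (j + k : ℝ) := Real.log_pos (by linarith)
  calc c / (j + k : ℝ) ^ 2 ≤ c / ((j + k) * Real.log (j + k)) := by
        rw [sq]
        gcongr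
    _ ≤ |((-j : ℤ) : ℝ) + (k : ℤ) * γ| := hcast ▸ hK
    _ = k * |γ - j / k| := by
        rw [← abs_of_pos (zero_lt_one.trans_le hk), ← abs_mul, abs_of_pos (zero_lt_one.trans_le hk)]
        congr 1
        push_cast
        field_simp
        ring

theorem IsGeneric.isDiophantine {γ : ℝ} (hγ : IsGeneric γ) : IsDiophantine γ := by
  obtain ⟨c, hc, h⟩ := hγ.exists_div_sq_le
  refine ⟨min 1 (c / (|γ| + 2) ^ 2), by positivity, 3, fun j k _ => ?_⟩
  have hk : (1 : ℝ) ≤ k := mod_cast k.pos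
  rcases le_total 1 |γ - j / k| with hfar | hnear
  · calc min 1 (c / (|γ| + 2) ^ 2) / (k : ℝ) ^ 3 ≤ 1 / 1 := by
          gcongr
          exacts [min_le_left _ _, one_le_pow₀ hk]
      _ ≤ |γ - j / k| := by simpa
  · have hfrac : (j : ℝ) / k ≤ |γ| + 1 := by linarith [neg_abs_le (γ - j / k), le_abs_self γ]
    have hsum : (j + k : ℝ) ≤ (|γ| + 2) * k := by
      rw [div_le_iff₀ (by positivity)] at hfrac
      linarith
    calc min 1 (c / (|γ| + 2) ^ 2) / (k : ℝ) ^ 3 ≤ c / (|γ| + 2) ^ 2 / (k : ℝ) ^ 3 := by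
          gcongr
          exact min_le_right _ _
      _ = c / ((|γ| + 2) * k) ^ 2 / k := by field_simp
      _ ≤ c / (j + k : ℝ) ^ 2 / k := by gcongr
      _ ≤ |γ - j / k| := by
          rw [div_le_iff₀' (by positivity)]
          exact h j k

theorem exists_elapsed_eq_zero {q : ℚ} (hq : 0 < q) : ∃ p, elapsed q p = 0 := by
  have hnum : 0 < q.num := Rat.num_pos.2 hq
  refine ⟨⟨(⟨q.den, q.pos⟩, ⟨q.num.natAbs, Int.natAbs_pos.2 hnum.ne'⟩), q.reduced⟩, ?_⟩
  rw [elapsed, sub_eq_zero, PNat.mk_coe, PNat.mk_coe, Nat.cast_natAbs, abs_of_pos hnum,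
    ← Rat.cast_def]

theorem elapsed_ne_zero_of_irrational {t : ℝ} (ht : Irrational t) (p : CoprimePair) :
    elapsed t p ≠ 0 := by
  have hne := ht.ne_rat ((p.1.2 : ℚ) / (p.1.1 : ℚ))
  push_cast at hne
  exact sub_ne_zero.2 hne

theorem elapsed_ne_zero_of_nonpos {t : ℝ} (ht : t ≤ 0) (p : CoprimePair) : elapsed t p ≠ 0 := by
  have hj : (0 : ℝ) < p.1.2 := mod_cast p.1.2.pos
  have hk : (0 : ℝ) < p.1.1 := mod_cast p.1.1.pos
  exact (sub_neg.2 (ht.trans_lt (div_pos hj hk))).ne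

end Times

end ZK

theorem theorem1p2_general :
    Summable ZK.term ∧
    (∀ t ≤ 0, ZK.IsCnOn ⊤ (ZK.W t ZK.u0) Set.univ) ∧
    ∃ X : Set ℝ,
      volume X = 0 ∧
      (∀ q : ℚ, (q : ℝ) ∈ X) ∧
      (∀ γ : ℝ, ZK.IsGeneric γ → γ ∉ X) ∧
      (∀ t ∉ X, ZK.IsCnOn ⊤ (ZK.W t ZK.u0) Set.univ) ∧
      (∀ q : ℚ, 0 < q →
        ZK.IsCnOn ⊤ (ZK.W q ZK.u0) {0}ᶜ ∧ ¬ ZK.IsCnOn 1 (ZK.W q ZK.u0) Set.univ) := by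
  refine ⟨ZK.summable_term, fun t ht => ?_, Set.range ((↑) : ℚ → ℝ) ∪ {t | ¬ ZK.IsDiophantine t},
    ?_, fun q => .inl ⟨q, rfl⟩, ?_, fun t ht => ?_, fun q hq => ?_⟩
  · exact ZK.isCnOn_univ_of_elapsed_ne_zero (ZK.isDiophantine_of_nonpos ht)
      (ZK.elapsed_ne_zero_of_nonpos ht)
  · exact measure_union_null ((Set.countable_range _).measure_zero _)
      ZK.volume_setOf_not_isDiophantine
  · rintro γ hγ (hrat | hndioph)
    exacts [hγ.1 hrat, hndioph hγ.isDiophantine]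
  · exact ZK.isCnOn_univ_of_elapsed_ne_zero (not_not.1 fun hndioph => ht (.inr hndioph))
      (ZK.elapsed_ne_zero_of_irrational fun hrat => ht (.inl hrat))
  · obtain ⟨p, hp⟩ := ZK.exists_elapsed_eq_zero hq
    exact ⟨ZK.isCnOn_compl_zero (ZK.isDiophantine_ratCast q),
      ZK.not_isCnOn_one (ZK.isDiophantine_ratCast q) hp⟩

theorem theorem1p2 :
    Summable ZK.term ∧
    ZK.IsCnOn (⊤ : ℕ∞) ZK.u0 Set.univ ∧
    ∃ X : Set ℝ,
      volume X = 0 ∧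
      (∀ q : ℚ, (q : ℝ) ∈ X) ∧
      (∀ γ : ℝ, ZK.IsGeneric γ → γ ∉ X) ∧
      (∀ t : ℝ, 0 < t → t ∉ X → ZK.IsCnOn (⊤ : ℕ∞) (ZK.W t ZK.u0) Set.univ) ∧
      (∀ q : ℚ, 0 < q →
        ZK.IsCnOn (⊤ : ℕ∞) (ZK.W (q : ℝ) ZK.u0) {0}ᶜ ∧
        ¬ ZK.IsCnOn 1 (ZK.W (q : ℝ) ZK.u0) Set.univ) := by
  obtain ⟨hsum, hnonpos, X, hX, hrat, hgen, hsmooth, hsing⟩ := theorem1p2_general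
  exact ⟨hsum, ZK.W_zero ZK.u0 ▸ hnonpos 0 le_rfl, X, hX, hrat, hgen, fun t _ => hsmooth t, hsing⟩
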